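/- An $r$-graph (a finite $r$-uniform hypergraph without repeated edges) is *linear* if any two distinct edges share at most one vertex; it is *$r$-partite with $r$-partition $A_1,\dots,A_r$* if its vertex set is the disjoint union of $A_1,\dots,A_r$ and every edge contains exactly one vertex of each $A_i$. The *link* of a vertex $v$ is $L_G(v)=\{I : |I|=r-1,\ I\cup\{v\}\in E(G)\}$, so $|L_G(v)|$ is the degree of $v$. The *linear cycle* $C^{(r)}_m$ is obtained from an $m$-cycle $v_1v_2\dots v_mv_1$ by enlarging each edge $v_iv_{i+1}$ (indices modulo $m$) by a set $I_i$ of $r-2$ new vertices, the sets $I_i$ being pairwise disjoint. The number $t_H(G)$ of copies of $H$ in $G$ is the number of subhypergraphs of $G$ isomorphic to $H$. **Theorem.** Let $k,r\ge 2$ be integers. For every real $\lambda\ge 1$ there is a constant $\alpha=\alpha(k,r,\lambda)>0$, and for every real $D\ge 2^{r+1}\,r\,k^r\,16^k$ there is an integer $n_0=n_0(k,r,D)$, such that the following holds for all real $\lambda\ge 1$ and $D\ge 2^{r+1}\,r\,k^r\,16^k$. If $G$ is a linear $r$-partite $r$-graph with $r$-partition $A_1,\dots,A_r$ such that $|A_1\cup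 A_2|=n\ge n_0$ and $$D n^{1/k}\le |L_G(v)|\le \lambda D n^{1/k}\qquad\text{for every } v\in A_1\cup A_2,$$ then $$t_{C^{(r)}_{2k}}(G)\ \ge\ \alpha\, n^2 .$$ -/

import Mathlib

namespace Hypergraph

/-- `G` is an `r`-graph: every edge has exactly `r` vertices (used with `r ≥ 2`). -/
def IsUniform {V : Type*} (G : Hypergraph V) (r : ℕ) : Prop :=
  ∀ e ∈ G.edgeSet, e.ncard = r

/-- `G` is linear: two distinct edges share at most one vertex. -/
def IsLinear {V : Type*} (G : Hypergraph V) : Prop :=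
  ∀ e ∈ G.edgeSet, ∀ f ∈ G.edgeSet, e ≠ f → (e ∩ f).Subsingleton

/-- `A` is an `r`-partition of `G`: the sets `A i` partition the vertex set of `G`
(empty parts allowed), and every edge contains exactly one vertex of each part. -/
structure IsRPartition {V : Type*} (G : Hypergraph V) {r : ℕ} (A : Fin r → Set V) : Prop where
  pairwise_disjoint : Pairwise fun i j => Disjoint (A i) (A j)
  iUnion_eq : ⋃ i, A i = G.vertexSet
  existsUnique_mem : ∀ e ∈ G.edgeSet, ∀ i, ∃! v, v ∈ e ∩ A i

/-- The link of `v` in the `r`-graph `G`: all `(r-1)`-sets of vertices that form an edge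
together with `v`. -/
def link {V : Type*} (G : Hypergraph V) (r : ℕ) (v : V) : Set (Set V) :=
  {I | I ⊆ G.vertexSet ∧ I.ncard = r - 1 ∧ insert v I ∈ G.edgeSet}

/-- The `r`-uniform linear cycle of length `m` (`r ≥ 2`, `m ≥ 3`): the `m`-cycle on the vertices
`Sum.inl i`, where each edge `{i, i + 1}` (indices modulo `m`) is enlarged by the `r - 2` new
vertices `Sum.inr (i, j)`. -/
def linearCycle (r m : ℕ) : Hypergraph (Fin m ⊕ Fin m × Fin (r - 2)) where
  vertexSet := Set.univ
  edgeSet := Set.range fun i : Fin m =>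
    {Sum.inl i, Sum.inl (finRotate m i)} ∪ Set.range fun j : Fin (r - 2) => Sum.inr (i, j)
  subset_vertexSet_of_mem_edgeSet' := fun _ _ => Set.subset_univ _

/-- The copies of `H` in `G`: the subhypergraphs of `G` that are isomorphic to `H`. -/
def copies {W V : Type*} (H : Hypergraph W) (G : Hypergraph V) : Set (Hypergraph V) :=
  {K | K.vertexSet ⊆ G.vertexSet ∧ K.edgeSet ⊆ G.edgeSet ∧
    ∃ f : W → V, Set.InjOn f H.vertexSet ∧ K = H.image f}

/-- The number of copies of `H` in `G` (used for finite `G`). -/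
noncomputable def copyCount {W V : Type*} (H : Hypergraph W) (G : Hypergraph V) : ℕ :=
  (copies H G).ncard

end Hypergraph

/-! Join two vertices of `A₁ ∪ A₂` when an edge of `G` contains both, and colour this shadow graph
by the remaining vertices of that edge. Linearity makes the colour classes matchings and gives
minimum degree at least `δ = D n^(1/k)`. A `2k`-cycle with no colour repeated between its edges
expands to a copy of the linear cycle, and each copy arises from boundedly many such closed walks,
so it suffices to count rainbow cycles.

Weight closed `2k`-walks by the normalized adjacency matrix `W`; the total weight is `tr W^(2k)`, at
least 1 because `W` has eigenvalue 1. For two given times, the walks that revisit a vertex or repeat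
a colour there contribute traces `tr (P W^a P W^b)`. Log-convexity in the exponents
(`trace_mul_pow_mul_pow_le`) bounds their weight by `O(1/δ) · tr W^(2k-2)`. As `δ^k = D^k n` with
`D` large, `mul_trace_pow_le` makes all bad walks together at most half of the total. A rainbow walk
weighs at most `δ^(-2k)`, so there are at least `δ^(2k)/2 ≥ n²/2` of them. -/

open Finset Matrix

/-! ### Spectral inequalities for traces of symmetric matrices. -/

section Spectral

variable {X : Type*} [Fintype X] [DecidableEq X]

/-- A real symmetric matrix is orthogonally diagonalizable. -/
lemma Matrix.IsSymm.exists_orthogonal_diagonalization {W : Matrix X X ℝ} (hW : W.IsSymm) :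
    ∃ (U : Matrix X X ℝ) (μ : X → ℝ), Uᵀ * U = 1 ∧ U * Uᵀ = 1 ∧
      ∀ a : ℕ, W ^ a = U * diagonal (fun p => μ p ^ a) * Uᵀ := by
  have hH : W.IsHermitian := by
    rw [Matrix.IsHermitian, conjTranspose_eq_transpose_of_trivial]; exact hW
  have hst : star (hH.eigenvectorUnitary : Matrix X X ℝ) =
      (hH.eigenvectorUnitary : Matrix X X ℝ)ᵀ := by
    rw [star_eq_conjTranspose, conjTranspose_eq_transpose_of_trivial]
  have h1 : (hH.eigenvectorUnitary : Matrix X X ℝ)ᵀ * hH.eigenvectorUnitary = 1 := by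
    rw [← hst]; exact Unitary.coe_star_mul_self _
  have h2 : (hH.eigenvectorUnitary : Matrix X X ℝ) * (hH.eigenvectorUnitary : Matrix X X ℝ)ᵀ = 1 := by
    rw [← hst]; exact Unitary.coe_mul_star_self _
  refine ⟨hH.eigenvectorUnitary, hH.eigenvalues, h1, h2, fun a => ?_⟩
  have hsp : W = (hH.eigenvectorUnitary : Matrix X X ℝ) * diagonal hH.eigenvalues *
      (hH.eigenvectorUnitary : Matrix X X ℝ)ᵀ := by
    conv_lhs => rw [hH.spectral_theorem]
    rw [Unitary.conjStarAlgAut_apply, hst]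
    rfl
  generalize (hH.eigenvectorUnitary : Matrix X X ℝ) = U at *
  generalize hH.eigenvalues = μ at *
  induction a with
  | zero => simp [h2]
  | succ a ih =>
    rw [pow_succ, ih]
    conv_lhs => rw [hsp]
    calc _ = U * diagonal (fun p => μ p ^ a) * (Uᵀ * U) * diagonal μ * Uᵀ := by
          simp only [Matrix.mul_assoc]
      _ = _ := by
          rw [h1, Matrix.mul_one, Matrix.mul_assoc U, diagonal_mul_diagonal]
          simp only [pow_succ]

/-- With `a = m + a'` and `b = m + b'`, the difference of the sides is `(st)^m (s^a' - t^a')(s^b' -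
t^b')`, whose last two factors have the same sign. -/
lemma pow_mul_pow_add_le {s t : ℝ} (hs : 0 ≤ s) (ht : 0 ≤ t) {m a b : ℕ} (ha : m ≤ a)
    (hb : m ≤ b) : s ^ a * t ^ b + s ^ b * t ^ a ≤
      s ^ m * t ^ (a + b - m) + s ^ (a + b - m) * t ^ m := by
  obtain ⟨a, rfl⟩ := Nat.exists_eq_add_of_le ha
  obtain ⟨b, rfl⟩ := Nat.exists_eq_add_of_le hb
  have h : m + a + (m + b) - m = m + a + b := by omega
  rw [h]
  have key : 0 ≤ (s ^ a - t ^ a) * (s ^ b - t ^ b) := by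
    rcases le_total s t with hst | hst
    · exact mul_nonneg_of_nonpos_of_nonpos (sub_nonpos.2 (pow_le_pow_left₀ hs hst a))
        (sub_nonpos.2 (pow_le_pow_left₀ hs hst b))
    · exact mul_nonneg (sub_nonneg.2 (pow_le_pow_left₀ ht hst a))
        (sub_nonneg.2 (pow_le_pow_left₀ ht hst b))
  have := mul_nonneg (mul_nonneg (pow_nonneg hs m) (pow_nonneg ht m)) key
  simp only [pow_add]
  nlinarith [this]

/-- Log-convexity of `a ↦ tr (P W ^ a P W ^ b)` along `a + b = const`, between even exponents. -/
lemma Matrix.IsSymm.trace_mul_pow_mul_pow_le {W P : Matrix X X ℝ} (hW : W.IsSymm) (hP : P.IsSymm)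
    {m l a b : ℕ} (hm : Even m) (hl : Even l) (hab : a + b = m + l) (ha : m ≤ a) (hb : m ≤ b) :
    trace (P * W ^ a * P * W ^ b) ≤ trace (P * W ^ m * P * W ^ l) := by
  obtain ⟨U, μ, -, -, hpow⟩ := hW.exists_orthogonal_diagonalization
  -- In an eigenbasis of `W` the trace is a combination of products of eigenvalue powers with
  -- non-negative coefficients `N p q ^ 2`.
  set N := Uᵀ * P * U with hN
  have hNs : ∀ p q, N p q = N q p := by
    have : Nᵀ = N := by
      rw [hN, transpose_mul, transpose_mul, transpose_transpose, hP.eq, Matrix.mul_assoc]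
    intro p q
    conv_lhs => rw [← this]
    rfl
  have key : ∀ a b : ℕ, trace (P * W ^ a * P * W ^ b) =
      ∑ p, ∑ q, N p q ^ 2 * (μ q ^ a * μ p ^ b) := by
    intro a b
    have : trace (P * W ^ a * P * W ^ b) =
        trace (N * diagonal (fun p => μ p ^ a) * (N * diagonal (fun p => μ p ^ b))) := by
      rw [hpow, hpow, hN]
      calc _ = trace ((P * U * diagonal (fun p => μ p ^ a) * Uᵀ * P * U *
              diagonal (fun p => μ p ^ b)) * Uᵀ) := by simp only [Matrix.mul_assoc]
        _ = _ := by rw [trace_mul_comm]; simp only [Matrix.mul_assoc]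
    rw [this, trace]
    refine sum_congr rfl fun p _ => ?_
    rw [diag_apply, mul_apply]
    refine sum_congr rfl fun q _ => ?_
    rw [mul_diagonal, mul_diagonal, hNs q p]
    ring
  -- The scalar inequality controls only the sum symmetrized in `p` and `q`.
  have sym : ∀ a b : ℕ, 2 * ∑ p, ∑ q, N p q ^ 2 * (|μ q| ^ a * |μ p| ^ b) =
      ∑ p, ∑ q, N p q ^ 2 * (|μ q| ^ a * |μ p| ^ b + |μ q| ^ b * |μ p| ^ a) := by
    intro a b
    rw [two_mul]
    conv_lhs => rhs; rw [sum_comm]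
    rw [← sum_add_distrib]
    refine sum_congr rfl fun p _ => ?_
    rw [← sum_add_distrib]
    refine sum_congr rfl fun q _ => ?_
    rw [hNs q p]
    ring
  -- Eigenvalues may be negative; the absolute values introduced here disappear at the end because
  -- `m` and `l` are even.
  have h1 : ∑ p, ∑ q, N p q ^ 2 * (μ q ^ a * μ p ^ b) ≤
      ∑ p, ∑ q, N p q ^ 2 * (|μ q| ^ a * |μ p| ^ b) := by
    refine sum_le_sum fun p _ => sum_le_sum fun q _ =>
      mul_le_mul_of_nonneg_left ?_ (sq_nonneg _)
    calc _ ≤ |μ q ^ a * μ p ^ b| := le_abs_self _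
      _ = _ := by rw [abs_mul, abs_pow, abs_pow]
  have h2 : ∑ p, ∑ q, N p q ^ 2 * (|μ q| ^ a * |μ p| ^ b + |μ q| ^ b * |μ p| ^ a) ≤
      ∑ p, ∑ q, N p q ^ 2 * (|μ q| ^ m * |μ p| ^ l + |μ q| ^ l * |μ p| ^ m) := by
    refine sum_le_sum fun p _ => sum_le_sum fun q _ =>
      mul_le_mul_of_nonneg_left ?_ (sq_nonneg _)
    have := pow_mul_pow_add_le (abs_nonneg (μ q)) (abs_nonneg (μ p)) ha hb
    rwa [hab, Nat.add_sub_cancel_left] at this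
  rw [key, key]
  rw [← sym, ← sym] at h2
  simp only [hm.pow_abs, hl.pow_abs] at h2
  linarith

/-- Split at `s = 4ε`: above it `ε ≤ s/4`, below it `s ≤ 4ε`. Summed over the spectrum, small
eigenvalues cost only a constant. -/
lemma mul_pow_le_quarter_add {ε s : ℝ} (hε : 0 ≤ ε) (hs : 0 ≤ s) (k : ℕ) :
    ε * s ^ k ≤ s ^ (k + 1) / 4 + (4 * ε) ^ (k + 1) / 4 := by
  rcases le_total (4 * ε) s with h | h
  · have h1 : 4 * ε * s ^ k ≤ s * s ^ k := by gcongr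
    have h2 : 0 ≤ (4 * ε) ^ (k + 1) := by positivity
    rw [pow_succ' s]
    linarith
  · have h1 : (4 * ε) * s ^ k ≤ (4 * ε) * (4 * ε) ^ k := by gcongr
    have h2 : 0 ≤ s ^ (k + 1) := by positivity
    rw [pow_succ' (4 * ε)]
    linarith

/-- If a symmetric matrix fixes a non-zero vector, then its `2k`-th moment dominates its
`2(k-1)`-st moment, up to a factor governed by the size of the matrix. -/
lemma Matrix.IsSymm.mul_trace_pow_le {W : Matrix X X ℝ} (hW : W.IsSymm) {v : X → ℝ} (hv : v ≠ 0)
    (hWv : W *ᵥ v = v) {k : ℕ} {ε : ℝ} (hε : 0 ≤ ε)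
    (hX : Fintype.card X * (4 * ε) ^ (k + 1) ≤ 1) :
    1 ≤ trace (W ^ (2 * (k + 1))) ∧
      ε * trace (W ^ (2 * k)) ≤ trace (W ^ (2 * (k + 1))) / 2 := by
  obtain ⟨U, μ, hU, hU', hpow⟩ := hW.exists_orthogonal_diagonalization
  have htr : ∀ a, trace (W ^ (2 * a)) = ∑ p, (μ p ^ 2) ^ a := by
    intro a
    rw [hpow, trace_mul_comm, ← Matrix.mul_assoc, hU, Matrix.one_mul, trace_diagonal]
    simp only [pow_mul]
  have h1 : 1 ≤ trace (W ^ (2 * (k + 1))) := by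
    -- Any non-zero coordinate of `v` in the eigenbasis exhibits an eigenvalue 1.
    have hy : Uᵀ *ᵥ v ≠ 0 := by
      intro h0
      apply hv
      have : U *ᵥ (Uᵀ *ᵥ v) = v := by rw [mulVec_mulVec, hU', one_mulVec]
      rw [← this, h0, mulVec_zero]
    obtain ⟨p, hp⟩ := Function.ne_iff.1 hy
    have hdiag : diagonal μ *ᵥ (Uᵀ *ᵥ v) = Uᵀ *ᵥ v := by
      have hW1 := hpow 1
      simp only [pow_one] at hW1
      conv_rhs => rw [← hWv, hW1]
      rw [mulVec_mulVec, mulVec_mulVec, ← Matrix.mul_assoc, ← Matrix.mul_assoc, hU,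
        Matrix.one_mul]
    have hμ : μ p = 1 := by
      have := congrFun hdiag p
      rw [mulVec_diagonal] at this
      exact mul_right_cancel₀ hp (this.trans (one_mul _).symm)
    rw [htr]
    calc (1 : ℝ) = (μ p ^ 2) ^ (k + 1) := by rw [hμ]; simp
      _ ≤ _ := single_le_sum (f := fun p => (μ p ^ 2) ^ (k + 1))
          (fun q _ => by positivity) (mem_univ p)
  refine ⟨h1, ?_⟩
  have : ε * trace (W ^ (2 * k)) ≤
      trace (W ^ (2 * (k + 1))) / 4 + Fintype.card X * (4 * ε) ^ (k + 1) / 4 := by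
    rw [htr, htr, mul_sum]
    calc _ ≤ ∑ p, ((μ p ^ 2) ^ (k + 1) / 4 + (4 * ε) ^ (k + 1) / 4) :=
          sum_le_sum fun p _ => mul_pow_le_quarter_add hε (sq_nonneg _) k
      _ = _ := by
        rw [sum_add_distrib, sum_div, sum_const, card_univ, nsmul_eq_mul, mul_div_assoc]
  linarith

end Spectral

/-! ### Traces of matrix products as sums over closed walks. -/

section Walks

variable {X R : Type*} [Fintype X] [DecidableEq X] [CommSemiring R]

/-- Expansion of an entry of a product of matrices as a sum over walks. -/
lemma Matrix.prod_range_apply (M : ℕ → Matrix X X R) (m : ℕ) (x y : X) :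
    ((List.range m).map M).prod x y = ∑ p : Fin (m + 1) → X,
      if p 0 = x ∧ p (Fin.last m) = y then ∏ i : Fin m, M i (p i.castSucc) (p i.succ) else 0 := by
  induction m generalizing y with
  | zero =>
    rw [← (Equiv.funUnique (Fin 1) X).symm.sum_comp]
    simp only [List.range_zero, List.map_nil, List.prod_nil, univ_eq_empty, prod_empty]
    simp [Matrix.one_apply, ite_and]
  | succ m ih =>
    rw [List.range_succ, List.map_append, List.prod_append]
    simp only [List.map_cons, List.map_nil, List.prod_singleton]
    rw [mul_apply, ← (Fin.snocEquiv fun _ : Fin (m + 2) => X).sum_comp, Fintype.sum_prod_type,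
      sum_comm]
    simp only [ih, sum_mul]
    rw [sum_comm]
    refine sum_congr rfl fun p _ => ?_
    have h0 : ∀ z : X, (Fin.snocEquiv fun _ : Fin (m + 2) => X) (z, p) 0 = p 0 := fun z => by
      change Fin.snoc (α := fun _ => X) p z (Fin.castSucc 0) = _
      rw [Fin.snoc_castSucc]
    have hl : ∀ z : X, (Fin.snocEquiv fun _ : Fin (m + 2) => X) (z, p) (Fin.last (m + 1)) = z :=
      fun z => Fin.snoc_last (α := fun _ => X) z p
    have hprod : ∀ z : X, (∏ i : Fin (m + 1), M i
        ((Fin.snocEquiv fun _ : Fin (m + 2) => X) (z, p) i.castSucc)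
        ((Fin.snocEquiv fun _ : Fin (m + 2) => X) (z, p) i.succ)) =
        (∏ i : Fin m, M i (p i.castSucc) (p i.succ)) * M m (p (Fin.last m)) z := by
      intro z
      have hc : ∀ i : Fin (m + 1),
          (Fin.snocEquiv fun _ : Fin (m + 2) => X) (z, p) i.castSucc = p i :=
        fun i => Fin.snoc_castSucc (α := fun _ => X) z p i
      rw [Fin.prod_univ_castSucc]
      simp only [hc, Fin.succ_castSucc, Fin.val_castSucc, Fin.val_last, Fin.succ_last, hl]
    simp only [h0, hl, hprod]
    by_cases hx : p 0 = x <;> simp [hx]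

/-- The trace of a product of matrices as a sum over closed walks. -/
lemma Matrix.trace_prod_range (M : ℕ → Matrix X X R) (m : ℕ) :
    trace ((List.range m).map M).prod = ∑ p : Fin (m + 1) → X with p 0 = p (Fin.last m),
      ∏ i : Fin m, M i (p i.castSucc) (p i.succ) := by
  rw [trace]
  simp only [diag_apply, prod_range_apply]
  rw [sum_comm, sum_filter]
  refine sum_congr rfl fun p _ => ?_
  simp only [ite_and]
  rw [sum_ite_eq]
  simp [eq_comm]

/-- Cyclicity of the trace merges the factors before position `i` with those after `j`. -/
lemma Matrix.trace_prod_range_two (W Q : Matrix X X R) {m i j : ℕ} (hij : i < j) (hj : j < m) :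
    trace ((List.range m).map fun l => if l = i ∨ l = j then Q else W).prod =
      trace (Q * W ^ (j - i - 1) * Q * W ^ (m - 1 - j + i)) := by
  obtain ⟨a, rfl⟩ := Nat.exists_eq_add_of_lt hij
  obtain ⟨b, rfl⟩ := Nat.exists_eq_add_of_lt hj
  have hconst : ∀ (c s : ℕ), (∀ l < c, s + l ≠ i ∧ s + l ≠ i + a + 1) →
      (((List.range c).map (s + ·)).map fun l => if l = i ∨ l = i + a + 1 then Q else W).prod =
        W ^ c := by
    intro c s h
    rw [List.map_map]
    have : List.map ((fun l => if l = i ∨ l = i + a + 1 then Q else W) ∘ (s + ·)) (List.range c) =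
        List.map (fun _ => W) (List.range c) := by
      refine List.map_congr_left fun l hl => ?_
      have := h l (List.mem_range.1 hl)
      simp [this]
    rw [this]
    simp
  have h0 := hconst i 0 (fun l hl => by omega)
  simp only [zero_add, List.map_id'] at h0
  have h1 := hconst a (i + 1) (fun l hl => by omega)
  have h2 := hconst b (i + 1 + a + 1) (fun l hl => by omega)
  have e : i + a + 1 + b + 1 = i + 1 + a + 1 + b := by omega
  have e1 : i + a + 1 - i - 1 = a := by omega
  have e2 : i + 1 + a + 1 + b - 1 - (i + a + 1) + i = b + i := by omega
  rw [e, e1, e2, List.range_add, List.map_append, List.prod_append, h2, List.range_succ,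
    List.map_append, List.prod_append, List.range_add, List.map_append, List.prod_append, h1,
    List.range_succ, List.map_append, List.prod_append, h0]
  have e3 : i + 1 + a = i + a + 1 := by omega
  simp only [List.map_cons, List.map_nil, List.prod_singleton, true_or, if_true, e3, or_true]
  calc _ = trace (W ^ i * (Q * W ^ a * Q * W ^ b)) := by simp only [Matrix.mul_assoc]
    _ = _ := by rw [trace_mul_comm, pow_add]; simp only [Matrix.mul_assoc]

end Walks

/-! ### The weight of closed walks with a repeated vertex or colour. -/

section Conflicts

variable {X : Type*} [Fintype X] [DecidableEq X]

/-- The weight of a walk: the product of the weights of its steps. -/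
def walkWeight (W : Matrix X X ℝ) {m : ℕ} (p : Fin (m + 1) → X) : ℝ :=
  ∏ i : Fin m, W (p i.castSucc) (p i.succ)

lemma sum_walkWeight_eq_trace_pow (W : Matrix X X ℝ) (m : ℕ) :
    ∑ p : Fin (m + 1) → X with p 0 = p (Fin.last m), walkWeight W p = trace (W ^ m) := by
  have := trace_prod_range (fun _ => W) m
  simp only [List.map_const', List.length_range, List.prod_replicate] at this
  exact this.symm

/-- The total weight of the closed walks whose `i`-th and `j`-th steps satisfy `S`. -/
lemma sum_walkWeight_restrict (W Q : Matrix X X ℝ) (S : X → X → Prop) [∀ x y, Decidable (S x y)]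
    (hQ : ∀ x y, Q x y = if S x y then W x y else 0) {m : ℕ} {i j : Fin m} (hij : i < j) :
    ∑ p : Fin (m + 1) → X with p 0 = p (Fin.last m), (if S (p i.castSucc) (p i.succ) ∧
        S (p j.castSucc) (p j.succ) then walkWeight W p else 0) =
      trace (Q * W ^ (j - i - 1 : ℕ) * Q * W ^ (m - 1 - j + i : ℕ)) := by
  rw [← trace_prod_range_two W Q (show (i : ℕ) < j from hij) j.2, trace_prod_range]
  refine sum_congr rfl fun p _ => ?_
  have hterm : ∀ l : Fin m, (if (l : ℕ) = i ∨ (l : ℕ) = j then Q else W) (p l.castSucc) (p l.succ) =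
      if ((l = i ∨ l = j) → S (p l.castSucc) (p l.succ)) then W (p l.castSucc) (p l.succ)
        else 0 := by
    intro l
    simp only [Fin.val_inj]
    by_cases h : l = i ∨ l = j
    · simp only [h, if_true, hQ, true_imp_iff]
    · simp only [h, if_false, false_imp_iff, if_true]
  simp only [hterm]
  split_ifs with h
  · refine prod_congr rfl fun l _ => ?_
    rw [if_pos]
    rintro (rfl | rfl)
    exacts [h.1, h.2]
  · rw [not_and_or] at h
    rcases h with h | h
    · exact (prod_eq_zero (mem_univ i) (by simp [h])).symm
    · exact (prod_eq_zero (mem_univ j) (by simp [h])).symm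

/-- The total weight of the closed walks that visit some vertex both at time `i` and `j`. -/
lemma sum_walkWeight_revisit_le {W : Matrix X X ℝ} (hW : W.IsSymm) (h0 : ∀ x y, 0 ≤ W x y)
    (hd : ∀ x, W x x = 0) {η : ℝ} (hη : ∀ x, ∑ y, W x y ^ 2 ≤ η) {k : ℕ}
    {i j : Fin (2 * (k + 1))} (hij : i < j) :
    ∑ p : Fin (2 * (k + 1) + 1) → X with p 0 = p (Fin.last _),
      (if p i.castSucc = p j.castSucc then walkWeight W p else 0) ≤ η * trace (W ^ (2 * k)) := by
  have hsq : ∀ z, (W ^ 2) z z = ∑ y, W z y ^ 2 := by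
    intro z
    rw [pow_two, mul_apply]
    refine sum_congr rfl fun y _ => ?_
    rw [pow_two, hW.apply z y]
  have hE : ∀ (z : X) (a b : ℕ), trace (single z z (1 : ℝ) * W ^ a * single z z 1 * W ^ b) =
      (W ^ a) z z * (W ^ b) z z := by
    intro z a b
    rw [single_mul_mul_single, trace_single_mul]
    simp
  have hij' : (i : ℕ) < j := hij
  have key : ∀ z, ∑ p : Fin (2 * (k + 1) + 1) → X with p 0 = p (Fin.last _),
      (if p i.castSucc = z ∧ p j.castSucc = z then walkWeight W p else 0) ≤
        η * (W ^ (2 * k)) z z := by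
    intro z
    rw [sum_walkWeight_restrict W (single z z 1 * W) (fun x _ => x = z) (fun x y => by
      split_ifs with h
      · rw [h, single_mul_apply_same, one_mul]
      · exact single_mul_apply_of_ne _ _ _ _ _ h _) hij]
    -- Each marked step gives its factor `W` back to the following power, so the exponents now sum
    -- to `2k + 2`.
    have e : single z z (1 : ℝ) * W * W ^ (j - i - 1 : ℕ) * (single z z (1 : ℝ) * W) *
        W ^ (2 * (k + 1) - 1 - j + i : ℕ) =
        single z z (1 : ℝ) * W ^ (j - i : ℕ) * single z z (1 : ℝ) *
          W ^ (2 * (k + 1) - j + i : ℕ) := by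
      have e1 : (j - i : ℕ) = (j - i - 1) + 1 := by omega
      have e2 : (2 * (k + 1) - j + i : ℕ) = (2 * (k + 1) - 1 - j + i) + 1 := by omega
      rw [e1, e2, pow_succ', pow_succ' W (2 * (k + 1) - 1 - j + i)]
      simp only [Matrix.mul_assoc, Nat.add_sub_cancel]
    rw [e]
    have hrhs : 0 ≤ η * (W ^ (2 * k)) z z :=
      mul_nonneg ((sum_nonneg fun y _ => sq_nonneg _).trans (hη z)) (Matrix.pow_apply_nonneg h0 _ _ _)
    -- An exponent 1 gives a zero diagonal entry. Otherwise both are at least 2 and convexity moves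
    -- them to `2` and `2k`, where `(W ^ 2) z z ≤ η`.
    rcases (show (j - i : ℕ) = 1 ∨ (2 * (k + 1) - j + i : ℕ) = 1 ∨
        (2 ≤ (j - i : ℕ) ∧ 2 ≤ (2 * (k + 1) - j + i : ℕ)) by omega) with h | h | ⟨h, h'⟩
    · rw [hE, h, pow_one, hd, zero_mul]; exact hrhs
    · rw [hE, h, pow_one, hd, mul_zero]; exact hrhs
    · refine (hW.trace_mul_pow_mul_pow_le (P := single z z 1) (m := 2) (l := 2 * k) ?_
        even_two (even_two_mul k) (by omega) h h').trans ?_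
      · rw [Matrix.IsSymm, transpose_single]
      · rw [hE, hsq]
        exact mul_le_mul_of_nonneg_right (hη z) (Matrix.pow_apply_nonneg h0 _ _ _)
  calc _ = ∑ z, ∑ p : Fin (2 * (k + 1) + 1) → X with p 0 = p (Fin.last _),
      (if p i.castSucc = z ∧ p j.castSucc = z then walkWeight W p else 0) := by
        rw [sum_comm]
        refine sum_congr rfl fun p _ => ?_
        simp only [ite_and]
        rw [sum_ite_eq]
        simp [eq_comm]
    _ ≤ ∑ z, η * (W ^ (2 * k)) z z := sum_le_sum fun z _ => key z
    _ = _ := by rw [← mul_sum]; rfl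

/-- The total weight of the closed walks whose `i`-th and `j`-th steps share a colour, where each
colour class is a matching and each edge has at most `s` colours. -/
lemma sum_walkWeight_sameColour_le {W : Matrix X X ℝ} (hW : W.IsSymm) (h0 : ∀ x y, 0 ≤ W x y)
    {η : ℝ} (hη : ∀ x, ∑ y, W x y ^ 2 ≤ η) {Y : Type*} [Fintype Y] (c : Y → X → X → Prop)
    [∀ w x y, Decidable (c w x y)] (hsymm : ∀ w x y, c w x y → c w y x)
    (hmatch : ∀ w x y z, c w x y → c w x z → y = z) {s : ℕ}
    (hs : ∀ x y, W x y ≠ 0 → #{w | c w x y} ≤ s) {k : ℕ} {i j : Fin (2 * (k + 1))} (hij : i < j) :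
    ∑ w, ∑ p : Fin (2 * (k + 1) + 1) → X with p 0 = p (Fin.last _),
      (if c w (p i.castSucc) (p i.succ) ∧ c w (p j.castSucc) (p j.succ) then walkWeight W p
        else 0) ≤ s * η * trace (W ^ (2 * k)) := by
  have hij' : (i : ℕ) < j := hij
  have key : ∀ w, ∑ p : Fin (2 * (k + 1) + 1) → X with p 0 = p (Fin.last _),
      (if c w (p i.castSucc) (p i.succ) ∧ c w (p j.castSucc) (p j.succ) then walkWeight W p
        else 0) ≤ ∑ x, (∑ y, if c w x y then W x y ^ 2 else 0) * (W ^ (2 * k)) x x := by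
    intro w
    set P : Matrix X X ℝ := of fun x y => if c w x y then W x y else 0 with hPdef
    have hPap : ∀ x y, P x y = if c w x y then W x y else 0 := fun x y => rfl
    have hP : P.IsSymm := by
      refine IsSymm.ext fun x y => ?_
      rw [hPap, hPap, hW.apply x y]
      exact if_congr ⟨hsymm _ _ _, hsymm _ _ _⟩ rfl rfl
    -- A matching has no path with two edges, so only backtracking survives in `P * P`.
    have hPP : P * P = diagonal fun x => ∑ y, if c w x y then W x y ^ 2 else 0 := by
      ext x z
      rw [mul_apply, diagonal_apply]
      split_ifs with hxz
      · subst hxz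
        refine sum_congr rfl fun y _ => ?_
        rw [hP.apply x y, hPap]
        split_ifs <;> simp [pow_two]
      · refine sum_eq_zero fun y _ => ?_
        rw [hPap, hPap]
        split_ifs with h1 h2
        · exact absurd (hmatch w y x z (hsymm _ _ _ h1) h2) hxz
        all_goals simp
    rw [sum_walkWeight_restrict W P (c w) hPap hij]
    -- The exponents sum to `2k`, and moving them to `0` and `2k` puts the two copies of `P` next to
    -- each other.
    refine (hW.trace_mul_pow_mul_pow_le hP (m := 0) (l := 2 * k) Even.zero
        (even_two_mul k) (by omega) (Nat.zero_le _) (Nat.zero_le _)).trans (le_of_eq ?_)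
    rw [pow_zero, Matrix.mul_one, hPP, trace]
    simp only [diag_apply, diagonal_mul]
  calc _ ≤ ∑ w, ∑ x, (∑ y, if c w x y then W x y ^ 2 else 0) * (W ^ (2 * k)) x x :=
        sum_le_sum fun w _ => key w
    _ = ∑ x, (∑ y, #{w | c w x y} * W x y ^ 2) * (W ^ (2 * k)) x x := by
        rw [sum_comm]
        refine sum_congr rfl fun x _ => ?_
        rw [← sum_mul, sum_comm]
        congr 1
        refine sum_congr rfl fun y _ => ?_
        rw [← sum_filter, sum_const, nsmul_eq_mul]
    _ ≤ ∑ x, (s * η) * (W ^ (2 * k)) x x := by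
        refine sum_le_sum fun x _ => mul_le_mul_of_nonneg_right ?_ (Matrix.pow_apply_nonneg h0 _ _ _)
        calc _ ≤ ∑ y, (s : ℝ) * W x y ^ 2 := by
              refine sum_le_sum fun y _ => ?_
              by_cases h : W x y = 0
              · simp [h]
              · exact mul_le_mul_of_nonneg_right (by exact_mod_cast hs x y h) (sq_nonneg _)
          _ ≤ _ := by
              rw [← mul_sum]
              exact mul_le_mul_of_nonneg_left (hη x) (Nat.cast_nonneg s)
    _ = _ := by rw [← mul_sum]; rfl

end Conflicts

/-! ### The normalized adjacency matrix. -/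

namespace SimpleGraph

variable {X : Type*} [Fintype X] (B : SimpleGraph X) [DecidableRel B.Adj]

/-- The normalized adjacency matrix of `B`. -/
noncomputable def normAdjMatrix : Matrix X X ℝ :=
  of fun x y => if B.Adj x y then (√(B.degree x))⁻¹ * (√(B.degree y))⁻¹ else 0

lemma normAdjMatrix_apply (x y : X) : B.normAdjMatrix x y =
    if B.Adj x y then (√(B.degree x))⁻¹ * (√(B.degree y))⁻¹ else 0 := rfl

lemma normAdjMatrix_isSymm : B.normAdjMatrix.IsSymm := by
  refine IsSymm.ext fun x y => ?_
  simp only [normAdjMatrix_apply, B.adj_comm x y, mul_comm]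

lemma normAdjMatrix_nonneg (x y : X) : 0 ≤ B.normAdjMatrix x y := by
  rw [normAdjMatrix_apply]
  split_ifs <;> positivity

/-- Supplies the eigenvalue 1 that keeps the even moments at least 1. -/
lemma normAdjMatrix_mulVec_sqrt_degree :
    B.normAdjMatrix *ᵥ (fun x => √(B.degree x)) = fun x => √(B.degree x) := by
  ext x
  have : ∀ y, B.normAdjMatrix x y * √(B.degree y) = if B.Adj x y then (√(B.degree x))⁻¹ else 0 := by
    intro y
    rw [normAdjMatrix_apply]
    split_ifs with h
    · have : 0 < B.degree y := (B.degree_pos_iff_exists_adj y).2 ⟨x, h.symm⟩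
      have : √(B.degree y : ℝ) ≠ 0 := by positivity
      field_simp
    · simp
  rw [mulVec, dotProduct]
  simp only [this]
  rw [← sum_filter, sum_const, nsmul_eq_mul, ← neighborFinset_eq_filter,
    card_neighborFinset_eq_degree, ← div_eq_mul_inv, Real.div_sqrt]

variable {B}

lemma normAdjMatrix_le {δ : ℝ} (hδ : 0 < δ) (hdeg : ∀ x, δ ≤ B.degree x)
    (x y : X) : B.normAdjMatrix x y ≤ δ⁻¹ := by
  rw [normAdjMatrix_apply]
  split_ifs
  · calc _ ≤ (√δ)⁻¹ * (√δ)⁻¹ := by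
          have := Real.sqrt_pos.2 hδ
          gcongr <;> exact hdeg _
      _ = _ := by rw [← mul_inv, Real.mul_self_sqrt hδ.le]
  · positivity

/-- The row of `x` averages `1 / deg y` over the neighbours `y` of `x`; this is the `η` of the
conflict bounds. -/
lemma sum_sq_normAdjMatrix_le {δ : ℝ} (hδ : 0 < δ) (hdeg : ∀ x, δ ≤ B.degree x)
    (x : X) : ∑ y, B.normAdjMatrix x y ^ 2 ≤ δ⁻¹ := by
  have hx : (0 : ℝ) < B.degree x := hδ.trans_le (hdeg x)
  calc _ ≤ ∑ y, if B.Adj x y then (B.degree x : ℝ)⁻¹ * δ⁻¹ else 0 := by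
        refine sum_le_sum fun y _ => ?_
        rw [normAdjMatrix_apply]
        split_ifs
        · rw [mul_pow, inv_pow, inv_pow, Real.sq_sqrt (Nat.cast_nonneg _),
            Real.sq_sqrt (Nat.cast_nonneg _)]
          gcongr
          exact hdeg y
        · simp
    _ = δ⁻¹ := by
        rw [← sum_filter, sum_const, nsmul_eq_mul, ← neighborFinset_eq_filter,
          card_neighborFinset_eq_degree, ← mul_assoc, mul_inv_cancel₀ hx.ne', one_mul]

end SimpleGraph

/-! ### Counting rainbow cycles. -/

namespace SimpleGraph

variable {X Y : Type*}

/-- A closed walk `p 0, …, p m = p 0` in `B` that traverses a cycle no two edges of which share a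
colour; `c w x y` says that the edge `xy` has the colour `w`. -/
structure IsRainbowCycle (B : SimpleGraph X) (c : Y → X → X → Prop) {m : ℕ}
    (p : Fin (m + 1) → X) : Prop where
  closed : p 0 = p (Fin.last m)
  adj : ∀ i : Fin m, B.Adj (p i.castSucc) (p i.succ)
  injective : Function.Injective fun i : Fin m => p i.castSucc
  rainbow : ∀ i j : Fin m, i ≠ j → ∀ w,
    ¬ (c w (p i.castSucc) (p i.succ) ∧ c w (p j.castSucc) (p j.succ))

open Classical in
/-- A graph with minimum degree `δ ≫ |X| ^ (1/(k+1))`, coloured so that the colour classes are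
matchings and every edge has at most `s` colours, contains at least `δ ^ (2k+2) / 2` rainbow closed
walks traversing a cycle of length `2k+2`. -/
theorem le_two_mul_card_isRainbowCycle [Fintype X] [Nonempty X] [Fintype Y] (B : SimpleGraph X)
    (c : Y → X → X → Prop) (hsymm : ∀ w x y, c w x y → c w y x)
    (hmatch : ∀ w x y z, c w x y → c w x z → y = z) {s : ℕ}
    (hs : ∀ x y, B.Adj x y → #{w | c w x y} ≤ s) {δ : ℝ} (hδ : 0 < δ)
    (hdeg : ∀ x, δ ≤ B.degree x) {k : ℕ}
    (hX : Fintype.card X * (4 * ((2 * (k + 1)) ^ 2 * (s + 1) * δ⁻¹)) ^ (k + 1) ≤ 1) :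
    δ ^ (2 * (k + 1)) ≤
      2 * #{p : Fin (2 * (k + 1) + 1) → X | B.IsRainbowCycle c p} := by
  set W := B.normAdjMatrix with hWdef
  -- At most `(2(k+1))²` pairs of times, each costing `δ⁻¹` for a revisited vertex and `s δ⁻¹` for a
  -- shared colour.
  set ε := (2 * (k + 1)) ^ 2 * (s + 1) * δ⁻¹ with hε
  have h0 := B.normAdjMatrix_nonneg
  have hwt0 : ∀ p : Fin (2 * (k + 1) + 1) → X, 0 ≤ walkWeight W p :=
    fun p => prod_nonneg fun i _ => h0 _ _
  have hη := fun x => sum_sq_normAdjMatrix_le hδ hdeg x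
  have hv : (fun x => √(B.degree x : ℝ)) ≠ 0 := by
    intro h
    obtain ⟨x⟩ := ‹Nonempty X›
    have h1 := congrFun h x
    have : 0 < √(B.degree x : ℝ) := Real.sqrt_pos.2 (hδ.trans_le (hdeg x))
    simp only [Pi.zero_apply] at h1
    linarith
  obtain ⟨hT, hTε⟩ := B.normAdjMatrix_isSymm.mul_trace_pow_le hv
    B.normAdjMatrix_mulVec_sqrt_degree (by positivity : 0 ≤ ε) hX
  set C : Finset (Fin (2 * (k + 1) + 1) → X) := {p | p 0 = p (Fin.last _)} with hC
  set pairs : Finset (Fin (2 * (k + 1)) × Fin (2 * (k + 1))) := {q | q.1 < q.2} with hpairs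
  -- Union bound: a closed walk has weight zero, has a conflict at some pair of times, or is a
  -- rainbow cycle.
  have hpoint : ∀ p ∈ C, walkWeight W p ≤
      (if B.IsRainbowCycle c p then δ⁻¹ ^ (2 * (k + 1)) else 0) +
        ∑ q ∈ pairs, ((if p q.1.castSucc = p q.2.castSucc then walkWeight W p else 0) +
          ∑ w, if c w (p q.1.castSucc) (p q.1.succ) ∧ c w (p q.2.castSucc) (p q.2.succ) then
            walkWeight W p else 0) := by
    intro p hp
    have hnn1 : ∀ q : Fin (2 * (k + 1)) × Fin (2 * (k + 1)), 0 ≤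
        ∑ w, if c w (p q.1.castSucc) (p q.1.succ) ∧ c w (p q.2.castSucc) (p q.2.succ) then
            walkWeight W p else 0 := fun q => sum_nonneg fun w _ => by
      split_ifs
      exacts [hwt0 p, le_rfl]
    have hnn2 : ∀ q : Fin (2 * (k + 1)) × Fin (2 * (k + 1)), 0 ≤
        if p q.1.castSucc = p q.2.castSucc then walkWeight W p else 0 := fun q => by
      split_ifs
      exacts [hwt0 p, le_rfl]
    have hnn : 0 ≤ if B.IsRainbowCycle c p then δ⁻¹ ^ (2 * (k + 1)) else 0 := by
      split_ifs <;> positivity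
    have hbad : ∀ q ∈ pairs, walkWeight W p ≤
        (if p q.1.castSucc = p q.2.castSucc then walkWeight W p else 0) +
          (∑ w, if c w (p q.1.castSucc) (p q.1.succ) ∧ c w (p q.2.castSucc) (p q.2.succ) then
            walkWeight W p else 0) → walkWeight W p ≤
      (if B.IsRainbowCycle c p then δ⁻¹ ^ (2 * (k + 1)) else 0) +
        ∑ q ∈ pairs, ((if p q.1.castSucc = p q.2.castSucc then walkWeight W p else 0) +
          ∑ w, if c w (p q.1.castSucc) (p q.1.succ) ∧ c w (p q.2.castSucc) (p q.2.succ) then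
            walkWeight W p else 0) := by
      intro q hq h
      have h1 := single_le_sum (f := fun q : Fin (2 * (k + 1)) × Fin (2 * (k + 1)) =>
        ((if p q.1.castSucc = p q.2.castSucc then walkWeight W p else 0) +
          ∑ w, if c w (p q.1.castSucc) (p q.1.succ) ∧ c w (p q.2.castSucc) (p q.2.succ) then
            walkWeight W p else 0)) (fun q _ => add_nonneg (hnn2 q) (hnn1 q)) hq
      exact (h.trans h1).trans (le_add_of_nonneg_left hnn)
    by_cases hadj : ∀ i : Fin (2 * (k + 1)), B.Adj (p i.castSucc) (p i.succ)
    swap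
    · push Not at hadj
      obtain ⟨i, hi⟩ := hadj
      have : walkWeight W p = 0 := prod_eq_zero (mem_univ i) (by
        rw [hWdef, normAdjMatrix_apply, if_neg hi])
      rw [this] at hnn1 hnn2 ⊢
      exact add_nonneg hnn (sum_nonneg fun q _ => add_nonneg (hnn2 q) (hnn1 q))
    by_cases hv : ∃ q ∈ pairs, p q.1.castSucc = p q.2.castSucc
    · obtain ⟨q, hq, h⟩ := hv
      refine hbad q hq ?_
      rw [if_pos h]
      exact le_add_of_nonneg_right (hnn1 q)
    by_cases hw : ∃ q ∈ pairs, ∃ w, c w (p q.1.castSucc) (p q.1.succ) ∧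
        c w (p q.2.castSucc) (p q.2.succ)
    · obtain ⟨q, hq, w, h⟩ := hw
      refine hbad q hq ?_
      refine le_trans ?_ (le_add_of_nonneg_left (hnn2 q))
      have h1 := single_le_sum (f := fun w => if c w (p q.1.castSucc) (p q.1.succ) ∧
        c w (p q.2.castSucc) (p q.2.succ) then walkWeight W p else 0) (fun w _ => by
          split_ifs
          exacts [hwt0 p, le_rfl]) (mem_univ w)
      rwa [if_pos h] at h1
    push Not at hv hw
    have hgood : B.IsRainbowCycle c p := by
      refine ⟨by simpa [hC] using hp, hadj, fun i j hij => ?_, fun i j hij w h => ?_⟩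
      · rcases lt_trichotomy i j with h | h | h
        · exact absurd hij (hv (i, j) (by simpa [hpairs] using h))
        · exact h
        · exact absurd hij.symm (hv (j, i) (by simpa [hpairs] using h))
      · rcases lt_or_gt_of_ne hij with h' | h'
        · exact hw (i, j) (by simpa [hpairs] using h') w h.1 h.2
        · exact hw (j, i) (by simpa [hpairs] using h') w h.2 h.1
    rw [if_pos hgood]
    refine le_add_of_le_of_nonneg ?_
      (sum_nonneg fun q _ => add_nonneg (hnn2 q) (hnn1 q))
    calc walkWeight W p ≤ ∏ _i : Fin (2 * (k + 1)), δ⁻¹ :=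
          prod_le_prod (fun i _ => h0 _ _) fun i _ => normAdjMatrix_le hδ hdeg _ _
      _ = _ := by simp
  have hpair : ∀ q ∈ pairs, ∑ p ∈ C,
      ((if p q.1.castSucc = p q.2.castSucc then walkWeight W p else 0) +
          ∑ w, if c w (p q.1.castSucc) (p q.1.succ) ∧ c w (p q.2.castSucc) (p q.2.succ) then
            walkWeight W p else 0) ≤ (s + 1) * δ⁻¹ * trace (W ^ (2 * k)) := by
    intro q hq
    have hq' : q.1 < q.2 := by simpa [hpairs] using hq
    rw [sum_add_distrib]
    have h1 := sum_walkWeight_revisit_le B.normAdjMatrix_isSymm h0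
      (fun x => by simp [normAdjMatrix_apply]) hη hq'
    have h2 := sum_walkWeight_sameColour_le B.normAdjMatrix_isSymm h0 hη c hsymm hmatch
      (fun x y hxy => hs x y (by
        by_contra h
        exact hxy (by rw [normAdjMatrix_apply, if_neg h]))) hq'
    rw [sum_comm] at h2
    calc _ ≤ δ⁻¹ * trace (W ^ (2 * k)) + s * δ⁻¹ * trace (W ^ (2 * k)) := add_le_add h1 h2
      _ = _ := by ring
  have htr0 : 0 ≤ trace (W ^ (2 * k)) :=
    sum_nonneg fun x _ => Matrix.pow_apply_nonneg h0 _ _ _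
  have hcard : (#pairs : ℝ) ≤ (2 * (k + 1)) ^ 2 := by
    have : #pairs ≤ (2 * (k + 1)) ^ 2 := by
      refine (card_le_univ _).trans (le_of_eq ?_)
      rw [Fintype.card_prod, Fintype.card_fin, pow_two]
    exact_mod_cast this
  have hmain : trace (W ^ (2 * (k + 1))) ≤
      #{p : Fin (2 * (k + 1) + 1) → X | B.IsRainbowCycle c p} * δ⁻¹ ^ (2 * (k + 1)) +
        ε * trace (W ^ (2 * k)) := by
    rw [← sum_walkWeight_eq_trace_pow]
    refine (sum_le_sum hpoint).trans ?_
    rw [sum_add_distrib]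
    refine add_le_add ?_ ?_
    · rw [← sum_filter, sum_const, nsmul_eq_mul]
      gcongr
      exact subset_univ _
    · rw [sum_comm]
      refine (sum_le_sum hpair).trans ?_
      rw [sum_const, nsmul_eq_mul, hε]
      calc _ ≤ ((2 * (k + 1)) ^ 2 : ℝ) * ((s + 1) * δ⁻¹ * trace (W ^ (2 * k))) := by gcongr
        _ = _ := by ring
  -- The conflicts take at most half of a trace that is at least 1.
  have : 1 / 2 ≤ #{p : Fin (2 * (k + 1) + 1) → X | B.IsRainbowCycle c p} *
      δ⁻¹ ^ (2 * (k + 1)) := by linarith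
  rw [inv_pow, ← div_eq_mul_inv, le_div_iff₀ (by positivity)] at this
  linarith

end SimpleGraph

/-! ### The shadow graph and its rainbow cycles as linear cycles. -/

namespace Hypergraph

variable {V : Type*} {G : Hypergraph V} {r : ℕ} {A : Fin r → Set V}

lemma IsLinear.eq_of_mem (hG : G.IsLinear) {e f : Set V} (he : e ∈ G.edgeSet)
    (hf : f ∈ G.edgeSet) {x y : V} (hxy : x ≠ y) (hxe : x ∈ e) (hye : y ∈ e) (hxf : x ∈ f)
    (hyf : y ∈ f) : e = f := by
  by_contra h
  exact hxy (hG e he f hf h ⟨hxe, hxf⟩ ⟨hye, hyf⟩)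

lemma IsRPartition.eq_of_mem (hA : G.IsRPartition A) {e : Set V} (he : e ∈ G.edgeSet) {l : Fin r}
    {x y : V} (hx : x ∈ e) (hy : y ∈ e) (hxl : x ∈ A l) (hyl : y ∈ A l) : x = y :=
  (hA.existsUnique_mem e he l).unique ⟨hx, hxl⟩ ⟨hy, hyl⟩

lemma IsRPartition.index_eq (hA : G.IsRPartition A) {i j : Fin r} {x : V} (hi : x ∈ A i)
    (hj : x ∈ A j) : i = j := by
  by_contra h
  exact Set.disjoint_left.1 (hA.pairwise_disjoint h) hi hj

/-- The graph on `S` in which two vertices are adjacent if they lie in a common edge of `G`. -/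
def shadow (G : Hypergraph V) (S : Set V) : SimpleGraph S where
  Adj x y := x ≠ y ∧ ∃ e ∈ G.edgeSet, (x : V) ∈ e ∧ (y : V) ∈ e
  symm := ⟨fun _ _ ⟨h, e, he, hx, hy⟩ => ⟨h.symm, e, he, hy, hx⟩⟩
  loopless := ⟨fun _ h => h.1 rfl⟩

/-- The vertices outside `S` colour the edges of the shadow: `w` is a colour of `xy` if some edge
of `G` contains `x`, `y` and `w`. -/
def shadowColour (G : Hypergraph V) (S : Set V) (w : ↥(G.vertexSet \ S)) (x y : S) : Prop :=
  x ≠ y ∧ ∃ e ∈ G.edgeSet, (x : V) ∈ e ∧ (y : V) ∈ e ∧ (w : V) ∈ e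

lemma shadowColour_symm {S : Set V} (w : ↥(G.vertexSet \ S)) (x y : S)
    (h : G.shadowColour S w x y) : G.shadowColour S w y x := by
  obtain ⟨hne, e, he, hx, hy, hw⟩ := h
  exact ⟨hne.symm, e, he, hy, hx, hw⟩

lemma IsRPartition.eq_of_ne_of_mem (hA : G.IsRPartition A) {i j : Fin r} {e : Set V}
    (he : e ∈ G.edgeSet) {x y z : V} (hx : x ∈ A i ∪ A j) (hy : y ∈ A i ∪ A j)
    (hz : z ∈ A i ∪ A j) (hxe : x ∈ e) (hye : y ∈ e) (hze : z ∈ e) (hxy : x ≠ y) (hxz : x ≠ z) :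
    y = z := by
  rcases hx with hx | hx <;> rcases hy with hy | hy <;> rcases hz with hz | hz <;>
    first
    | exact absurd (hA.eq_of_mem he hxe hye hx hy) hxy
    | exact absurd (hA.eq_of_mem he hxe hze hx hz) hxz
    | exact hA.eq_of_mem he hye hze hy hz

/-- By linearity `x` and `w` determine the edge, which has only one vertex besides `x` in the two
parts. -/
lemma shadowColour_matching (hG : G.IsLinear) (hA : G.IsRPartition A) {i j : Fin r}
    (w : ↥(G.vertexSet \ (A i ∪ A j))) (x y z : ↥(A i ∪ A j))
    (hy : G.shadowColour _ w x y) (hz : G.shadowColour _ w x z) : y = z := by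
  obtain ⟨hxy, e, he, hxe, hye, hwe⟩ := hy
  obtain ⟨hxz, f, hf, hxf, hzf, hwf⟩ := hz
  have hxw : (x : V) ≠ w := fun h => w.2.2 (h ▸ x.2)
  obtain rfl := hG.eq_of_mem he hf hxw hxe hwe hxf hwf
  exact Subtype.ext (hA.eq_of_ne_of_mem he x.2 y.2 z.2 hxe hye hzf
    (fun h => hxy (Subtype.ext h)) (fun h => hxz (Subtype.ext h)))

-- By linearity `x` and `y` determine the edge, and all colours lie in it; the crude bound `r`
-- suffices.
open Classical in
lemma card_shadowColour_le (hfin : G.vertexSet.Finite) (hu : G.IsUniform r) (hG : G.IsLinear)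
    {S : Set V} [Fintype ↥(G.vertexSet \ S)] {x y : S} (hxy : (G.shadow S).Adj x y) :
    #{w | G.shadowColour S w x y} ≤ r := by
  obtain ⟨hne, e, he, hx, hy⟩ := hxy
  have hefin : e.Finite := hfin.subset (G.subset_vertexSet_of_mem_edgeSet' he)
  rw [← hu e he, ← Set.ncard_coe_finset]
  refine Set.ncard_le_ncard_of_injOn (fun w => (w : V)) ?_ Subtype.val_injective.injOn hefin
  intro w hw
  rw [mem_coe, mem_filter] at hw
  obtain ⟨-, -, f, hf, hxf, hyf, hwf⟩ := hw
  have := hG.eq_of_mem he hf (fun h => hne (Subtype.ext h)) hx hy hxf hyf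
  exact this ▸ hwf

/-- Each link set gives the vertex of its edge in the part not containing `x`; by linearity that
neighbour determines the edge. -/
lemma ncard_link_le_degree (hr : 2 ≤ r) (hu : G.IsUniform r) (hG : G.IsLinear)
    (hA : G.IsRPartition A) {i j : Fin r} (hij : i ≠ j) [Fintype ↥(A i ∪ A j)]
    [DecidableRel (G.shadow (A i ∪ A j)).Adj] (x : ↥(A i ∪ A j)) :
    (G.link r x).ncard ≤ (G.shadow (A i ∪ A j)).degree x := by
  have hex : ∀ I : Set V, ∃ y : ↥(A i ∪ A j),
      I ∈ G.link r x → x ≠ y ∧ (y : V) ∈ insert (x : V) I := by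
    intro I
    by_cases hI : I ∈ G.link r x
    swap
    · exact ⟨x, fun h => absurd h hI⟩
    have he := hI.2.2
    rcases x.2 with hx | hx
    · obtain ⟨y, ⟨hye, hyj⟩, -⟩ := hA.existsUnique_mem _ he j
      exact ⟨⟨y, Or.inr hyj⟩, fun _ => ⟨fun h => hij (hA.index_eq hx (by rw [h]; exact hyj)), hye⟩⟩
    · obtain ⟨y, ⟨hye, hyi⟩, -⟩ := hA.existsUnique_mem _ he i
      exact ⟨⟨y, Or.inl hyi⟩,
        fun _ => ⟨fun h => hij (hA.index_eq hx (by rw [h]; exact hyi)).symm, hye⟩⟩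
  choose f hf using hex
  have hnot : ∀ I ∈ G.link r x, (x : V) ∉ I := by
    intro I hI hxI
    have h1 := hu _ hI.2.2
    rw [Set.insert_eq_of_mem hxI, hI.2.1] at h1
    omega
  rw [← SimpleGraph.card_neighborFinset_eq_degree, ← Set.ncard_coe_finset]
  refine Set.ncard_le_ncard_of_injOn f ?_ ?_ (Finset.finite_toSet _)
  · intro I hI
    rw [mem_coe, SimpleGraph.mem_neighborFinset]
    exact ⟨(hf I hI).1, _, hI.2.2, Set.mem_insert _ _, (hf I hI).2⟩
  · intro I hI J hJ hIJ
    have h1 := hf I hI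
    have h2 := hf J hJ
    rw [← hIJ] at h2
    have h3 : insert (x : V) I = insert (x : V) J :=
      hG.eq_of_mem hI.2.2 hJ.2.2 (fun h => h1.1 (Subtype.ext h)) (Set.mem_insert _ _) h1.2
        (Set.mem_insert _ _) h2.2
    rw [← Set.insert_sdiff_self_of_notMem (hnot I hI), h3,
      Set.insert_sdiff_self_of_notMem (hnot J hJ)]

/-- `V` may be infinite and `ncard` vanishes on infinite sets, so lower bounds on `copyCount` need
this. -/
lemma finite_copies {W : Type*} [Finite W] {H : Hypergraph W} (hH : H.vertexSet = Set.univ)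
    (hfin : G.vertexSet.Finite) : (copies H G).Finite := by
  refine ((Set.Finite.pi' fun _ : W => hfin).image fun f => H.image f).subset ?_
  rintro K ⟨hK, -, f, -, rfl⟩
  exact ⟨f, fun w => hK ⟨w, hH ▸ Set.mem_univ w, rfl⟩, rfl⟩

lemma apply_succ_eq_finRotate {X : Type*} {n : ℕ} {p : Fin (n + 2) → X}
    (hp : p 0 = p (Fin.last (n + 1))) (i : Fin (n + 1)) :
    p i.succ = p (finRotate (n + 1) i).castSucc := by
  induction i using Fin.lastCases with
  | last => rw [finRotate_last, Fin.succ_last, Fin.castSucc_zero, hp]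
  | cast j => rw [finRotate_apply, Fin.coeSucc_eq_succ, Fin.succ_castSucc]

/-- A rainbow cycle in the shadow on two parts spans a linear cycle in `G`. -/
lemma exists_copy_of_isRainbowCycle (hr : 2 ≤ r) (hA : G.IsRPartition A)
    {n : ℕ} (p : Fin (n + 2) → ↥(A ⟨0, by omega⟩ ∪ A ⟨1, by omega⟩))
    (hp : (G.shadow _).IsRainbowCycle (G.shadowColour _) p) :
    ∃ K ∈ copies (linearCycle r (n + 1)) G,
      K.vertexSet.ncard ≤ (n + 1) + (n + 1) * (r - 2) ∧ ∀ i, (p i : V) ∈ K.vertexSet := by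
  have hedge : ∀ i : Fin (n + 1), ∃ e ∈ G.edgeSet, (p i.castSucc : V) ∈ e ∧ (p i.succ : V) ∈ e :=
    fun i => (hp.adj i).2
  choose e heG hep hep' using hedge
  have hpart : ∀ (i : Fin (n + 1)) (l : Fin r), ∃ v, v ∈ e i ∩ A l :=
    fun i l => (hA.existsUnique_mem _ (heG i) l).exists
  choose u hu using hpart
  -- The enlarging vertices of the `i`-th edge are its representatives in the parts of index at
  -- least 2.
  set f : Fin (n + 1) ⊕ Fin (n + 1) × Fin (r - 2) → V :=
    Sum.elim (fun i => (p i.castSucc : V)) fun q => u q.1 ⟨q.2 + 2, by omega⟩ with hf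
  have hvert : ∀ i, e i ⊆ G.vertexSet := fun i => G.subset_vertexSet_of_mem_edgeSet' (heG i)
  have hout : ∀ (i : Fin (n + 1)) (j : Fin (r - 2)),
      u i ⟨j + 2, by omega⟩ ∉ A ⟨0, by omega⟩ ∪ A ⟨1, by omega⟩ := by
    rintro i j (h | h)
    · have := congrArg Fin.val (hA.index_eq (hu i _).2 h)
      simp at this
    · have := congrArg Fin.val (hA.index_eq (hu i _).2 h)
      simp at this
  have hinj : Function.Injective f := by
    rintro (i | ⟨i, j⟩) (i' | ⟨i', j'⟩) h
    · exact congrArg _ (hp.injective (Subtype.ext h))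
    · exact absurd (p i.castSucc).2 (by
        rw [show (p i.castSucc : V) = u i' ⟨j' + 2, by omega⟩ from h]
        exact hout i' j')
    · exact absurd (p i'.castSucc).2 (by
        rw [show (p i'.castSucc : V) = u i ⟨j + 2, by omega⟩ from h.symm]
        exact hout i j)
    -- Equal enlarging vertices lie in the same part; coming from different edges they would be a
    -- shared colour, which rainbowness forbids.
    · have h' : u i ⟨j + 2, by omega⟩ = u i' ⟨j' + 2, by omega⟩ := h
      have hj : j = j' := by
        have := congrArg Fin.val
          (hA.index_eq (hu i ⟨j + 2, by omega⟩).2 (h' ▸ (hu i' ⟨j' + 2, by omega⟩).2))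
        simp only [Nat.add_right_cancel_iff] at this
        exact Fin.ext this
      subst hj
      by_cases hi : i = i'
      · rw [hi]
      · refine absurd ⟨?_, ?_⟩
          (hp.rainbow i i' hi ⟨u i ⟨j + 2, by omega⟩, hvert i (hu i _).1, hout i j⟩)
        · exact ⟨(hp.adj i).1, e i, heG i, hep i, hep' i, (hu i _).1⟩
        · refine ⟨(hp.adj i').1, e i', heG i', hep i', hep' i', ?_⟩
          change u i ⟨j + 2, by omega⟩ ∈ e i'
          rw [h']
          exact (hu i' _).1
  have himage : ∀ i : Fin (n + 1), f '' ({Sum.inl i, Sum.inl (finRotate (n + 1) i)} ∪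
      Set.range fun j : Fin (r - 2) => Sum.inr (i, j)) = e i := by
    intro i
    have hrot : f (Sum.inl (finRotate (n + 1) i)) = p i.succ := by
      rw [apply_succ_eq_finRotate hp.closed i]
      rfl
    ext v
    rw [Set.image_union, Set.image_pair, hrot, ← Set.range_comp]
    constructor
    · rintro ((rfl | rfl) | ⟨j, rfl⟩)
      exacts [hep i, hep' i, (hu i _).1]
    · intro hv
      have hvG := hvert i hv
      rw [← hA.iUnion_eq, Set.mem_iUnion] at hvG
      obtain ⟨l, hl⟩ := hvG
      by_cases hl2 : 2 ≤ (l : ℕ)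
      · refine Or.inr ⟨⟨l - 2, by omega⟩, ?_⟩
        have hl' : (⟨(l : ℕ) - 2 + 2, by omega⟩ : Fin r) = l := Fin.ext (by simp; omega)
        change u i ⟨(l : ℕ) - 2 + 2, _⟩ = v
        rw [hl']
        exact hA.eq_of_mem (heG i) (hu i l).1 hv (hu i l).2 hl
      · left
        have hvS : v ∈ A ⟨0, by omega⟩ ∪ A ⟨1, by omega⟩ := by
          rcases (show (l : ℕ) = 0 ∨ (l : ℕ) = 1 by omega) with h | h
          · left; convert hl; exact h.symm
          · right; convert hl; exact h.symm
        by_contra hcon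
        rw [Set.mem_insert_iff, Set.mem_singleton_iff, not_or] at hcon
        exact hcon.2 (hA.eq_of_ne_of_mem (heG i) (p i.castSucc).2 hvS (p i.succ).2 (hep i) hv
          (hep' i) (Ne.symm hcon.1) fun h => (hp.adj i).1 (Subtype.ext h))
  have hfV : ∀ q, f q ∈ G.vertexSet := by
    rintro (i | ⟨i, j⟩)
    exacts [hvert i (hep i), hvert i (hu i _).1]
  refine ⟨(linearCycle r (n + 1)).image f, ⟨?_, ?_, f, hinj.injOn, rfl⟩, ?_, ?_⟩
  · rintro _ ⟨q, -, rfl⟩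
    exact hfV q
  · rintro _ ⟨_, ⟨i, rfl⟩, rfl⟩
    rw [himage i]
    exact heG i
  · refine (Set.ncard_image_le (Set.toFinite _)).trans (le_of_eq ?_)
    change (Set.univ : Set (Fin (n + 1) ⊕ Fin (n + 1) × Fin (r - 2))).ncard = _
    rw [Set.ncard_univ, Nat.card_eq_fintype_card]
    simp
  · intro i
    induction i using Fin.lastCases with
    | last => rw [← hp.closed]; exact ⟨Sum.inl 0, trivial, rfl⟩
    | cast i => exact ⟨Sum.inl i, trivial, rfl⟩

open Classical in
/-- Every linear cycle of `G` is spanned by boundedly many rainbow cycles of the shadow. -/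
lemma card_isRainbowCycle_le (hr : 2 ≤ r) (hfin : G.vertexSet.Finite)
    (hA : G.IsRPartition A) {n : ℕ} [Fintype ↥(A ⟨0, by omega⟩ ∪ A ⟨1, by omega⟩)] :
    #{p : Fin (n + 2) → ↥(A ⟨0, by omega⟩ ∪ A ⟨1, by omega⟩) |
        (G.shadow _).IsRainbowCycle (G.shadowColour _) p} ≤
      ((n + 1) + (n + 1) * (r - 2)) ^ (n + 2) * copyCount (linearCycle r (n + 1)) G := by
  set X := ↥(A ⟨0, by omega⟩ ∪ A ⟨1, by omega⟩)
  have hex : ∀ p : Fin (n + 2) → X, ∃ K : Hypergraph V,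
      (G.shadow _).IsRainbowCycle (G.shadowColour _) p → K ∈ copies (linearCycle r (n + 1)) G ∧
        K.vertexSet.ncard ≤ (n + 1) + (n + 1) * (r - 2) ∧ ∀ i, (p i : V) ∈ K.vertexSet := by
    intro p
    by_cases hp : (G.shadow _).IsRainbowCycle (G.shadowColour _) p
    · obtain ⟨K, hK⟩ := exists_copy_of_isRainbowCycle hr hA p hp
      exact ⟨K, fun _ => hK⟩
    -- Arbitrary value for walks that are not rainbow cycles.
    · exact ⟨G, fun h => absurd h hp⟩
  choose φ hφ using hex
  refine (card_le_mul_card_image (f := φ) _ (((n + 1) + (n + 1) * (r - 2)) ^ (n + 2)) ?_).trans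
    (Nat.mul_le_mul_left _ ?_)
  -- All walks sent to one copy take their `n + 2` values among its vertices.
  · intro K hK
    obtain ⟨p₀, hp₀, rfl⟩ := mem_image.1 hK
    have h₀ := hφ p₀ (mem_filter.1 hp₀).2
    have hKfin : (φ p₀).vertexSet.Finite := hfin.subset h₀.1.1
    have hT : #{x : X | (x : V) ∈ (φ p₀).vertexSet} ≤ (n + 1) + (n + 1) * (r - 2) := by
      refine le_trans ?_ h₀.2.1
      rw [← Set.ncard_coe_finset]
      exact Set.ncard_le_ncard_of_injOn (fun x => (x : V)) (fun x hx => by simpa using hx)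
        Subtype.val_injective.injOn hKfin
    calc _ ≤ #(Fintype.piFinset fun _ : Fin (n + 2) => {x : X | (x : V) ∈ (φ p₀).vertexSet}) := by
          refine card_le_card fun p hp => ?_
          rw [mem_filter, mem_filter] at hp
          rw [Fintype.mem_piFinset]
          intro i
          rw [mem_filter, ← hp.2]
          exact ⟨mem_univ _, (hφ p hp.1.2).2.2 i⟩
      _ ≤ _ := by
          rw [Fintype.card_piFinset, prod_const, card_univ, Fintype.card_fin]
          exact Nat.pow_le_pow_left hT _
  · rw [copyCount, ← Set.ncard_coe_finset]
    refine Set.ncard_le_ncard ?_ (finite_copies rfl hfin)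
    intro K hK
    obtain ⟨p, hp, rfl⟩ := mem_image.1 (mem_coe.1 hK)
    exact (hφ p (mem_filter.1 hp).2).1

end Hypergraph

/-! ### Choice of constants and conclusion. -/

/-- The left side is `4εδ` with `s = r` and walks of length `2k`; since `δ^k = D^k n`, having it at
most `D` gives `n (4ε)^k ≤ 1`. -/
lemma degree_constant_le {k r : ℕ} (hk : 2 ≤ k) (hr : 2 ≤ r) :
    4 * ((2 * (k : ℝ)) ^ 2 * (r + 1)) ≤ (2 : ℝ) ^ (r + 1) * r * (k : ℝ) ^ r * 16 ^ k := by
  have hk' : (2 : ℝ) ≤ k := by exact_mod_cast hk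
  have hr' : (2 : ℝ) ≤ r := by exact_mod_cast hr
  have h1 : (2 : ℝ) ^ 1 ≤ 2 ^ (r + 1) := pow_le_pow_right₀ (by norm_num) (by omega)
  have h2 : (k : ℝ) ^ 2 ≤ (k : ℝ) ^ r := pow_le_pow_right₀ (by linarith) hr
  have h3 : (16 : ℝ) ^ 1 ≤ 16 ^ k := pow_le_pow_right₀ (by norm_num) (by omega)
  calc 4 * ((2 * (k : ℝ)) ^ 2 * (r + 1)) ≤ (2 : ℝ) ^ 1 * r * (k : ℝ) ^ 2 * 16 ^ 1 := by
        nlinarith [sq_nonneg (k : ℝ)]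
    _ ≤ _ := by gcongr

theorem theorem5p7 (k r : ℕ) (hk : 2 ≤ k) (hr : 2 ≤ r) :
    ∃ α : ℝ → ℝ, (∀ lam : ℝ, 1 ≤ lam → 0 < α lam) ∧
      ∀ D : ℝ, (2 : ℝ) ^ (r + 1) * (r : ℝ) * (k : ℝ) ^ r * (16 : ℝ) ^ k ≤ D →
        ∃ n₀ : ℕ, ∀ lam : ℝ, 1 ≤ lam →
          ∀ (V : Type*) (G : Hypergraph V) (A : Fin r → Set V) (n : ℕ),
            G.vertexSet.Finite → G.IsUniform r → G.IsLinear → G.IsRPartition A →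
            (A ⟨0, by omega⟩ ∪ A ⟨1, by omega⟩).ncard = n → n₀ ≤ n →
            (∀ v ∈ A ⟨0, by omega⟩ ∪ A ⟨1, by omega⟩,
              D * (n : ℝ) ^ (1 / (k : ℝ)) ≤ ((G.link r v).ncard : ℝ) ∧
              ((G.link r v).ncard : ℝ) ≤ lam * D * (n : ℝ) ^ (1 / (k : ℝ))) →
            α lam * (n : ℝ) ^ 2 ≤ (((Hypergraph.linearCycle r (2 * k)).copyCount G : ℕ) : ℝ) := by
  classical
  have hr₀ : 0 < r := by omega
  have hr₁ : 1 < r := by omega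
  -- Bounds the number of rainbow closed walks per copy: vertices of the linear cycle to the power
  -- of the number of walk entries.
  set N : ℝ := ((2 * k + 2 * k * (r - 2) : ℕ) : ℝ) ^ (2 * k + 1) with hN
  have hNpos : 0 < N := by
    have : 0 < 2 * k + 2 * k * (r - 2) := by positivity
    positivity
  -- The threshold `n₀ = 1` only ensures that the shadow has a vertex.
  refine ⟨fun _ => (2 * N)⁻¹, fun _ _ => by positivity, fun D hD => ⟨1, ?_⟩⟩
  intro lam _ V G A n hfin hu hG hA hn hn1 hdeg
  have hD' := (degree_constant_le hk hr).trans hD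
  have hD1 : 1 ≤ D := by
    have hk' : (2 : ℝ) ≤ k := by exact_mod_cast hk
    refine le_trans ?_ hD'
    have : (0 : ℝ) ≤ r := Nat.cast_nonneg r
    nlinarith [sq_nonneg (k : ℝ), mul_nonneg (sq_nonneg (k : ℝ)) this]
  have hDpos : 0 < D := by linarith
  have hsub : ∀ l, A l ⊆ G.vertexSet := fun l => hA.iUnion_eq ▸ Set.subset_iUnion A l
  have hSfin : (A ⟨0, hr₀⟩ ∪ A ⟨1, hr₁⟩).Finite :=
    hfin.subset (Set.union_subset (hsub _) (hsub _))
  have : Fintype ↥(A ⟨0, hr₀⟩ ∪ A ⟨1, hr₁⟩) := hSfin.fintype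
  have : Fintype ↥(G.vertexSet \ (A ⟨0, hr₀⟩ ∪ A ⟨1, hr₁⟩)) :=
    (hfin.subset Set.sdiff_subset).fintype
  have hcard : Fintype.card ↥(A ⟨0, hr₀⟩ ∪ A ⟨1, hr₁⟩) = n := by
    rw [← hn, ← Nat.card_coe_set_eq, Nat.card_eq_fintype_card]
  have : Nonempty ↥(A ⟨0, hr₀⟩ ∪ A ⟨1, hr₁⟩) := by
    rw [← Fintype.card_pos_iff, hcard]
    omega
  have hnpos : (0 : ℝ) < n := by exact_mod_cast hn1
  set δ : ℝ := D * (n : ℝ) ^ (1 / (k : ℝ)) with hδ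
  have hδpos : 0 < δ := by positivity
  have hδk : δ ^ k = D ^ k * n := by
    rw [hδ, mul_pow, one_div, Real.rpow_inv_natCast_pow hnpos.le (by omega)]
  obtain ⟨k', rfl⟩ : ∃ k', k = k' + 1 := ⟨k - 1, by omega⟩
  have hmain := SimpleGraph.le_two_mul_card_isRainbowCycle (k := k') (s := r) (δ := δ)
    (G.shadow (A ⟨0, hr₀⟩ ∪ A ⟨1, hr₁⟩)) (G.shadowColour _)
    Hypergraph.shadowColour_symm (Hypergraph.shadowColour_matching hG hA)
    (fun x y hxy => Hypergraph.card_shadowColour_le hfin hu hG hxy) hδpos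
    (fun x => (hdeg x x.2).1.trans (by
      exact_mod_cast Hypergraph.ncard_link_le_degree hr hu hG hA (by simp) x))
    (by
      rw [hcard, ← mul_assoc 4, mul_pow, inv_pow, hδk]
      have h1 : (4 * ((2 * ((k' : ℝ) + 1)) ^ 2 * (r + 1))) ^ (k' + 1) ≤ D ^ (k' + 1) := by
        push_cast at hD'
        gcongr
      rw [← mul_assoc, ← div_eq_mul_inv, div_le_one (by positivity), mul_comm]
      gcongr)
  have hle : δ ^ (2 * (k' + 1)) ≤
      2 * (N * (((Hypergraph.linearCycle r (2 * (k' + 1))).copyCount G : ℕ) : ℝ)) := by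
    refine hmain.trans ?_
    have := Hypergraph.card_isRainbowCycle_le (n := 2 * k' + 1) hr hfin hA
    gcongr
    rw [hN]
    exact_mod_cast this
  have hn2 : (n : ℝ) ^ 2 ≤ δ ^ (2 * (k' + 1)) := by
    rw [mul_comm 2, pow_mul, hδk]
    have : (1 : ℝ) ≤ D ^ (k' + 1) := one_le_pow₀ hD1
    gcongr
    nlinarith
  calc (2 * N)⁻¹ * (n : ℝ) ^ 2 ≤ (2 * N)⁻¹ *
        (2 * (N * (((Hypergraph.linearCycle r (2 * (k' + 1))).copyCount G : ℕ) : ℝ))) := by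
        gcongr
        exact hn2.trans hle
    _ = _ := by
        field_simp
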